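/- Consider a leader $x_r(k+1)=Sx_r(k)$, $y_r(k)=Rx_r(k)$ with known $S\in\mathbb R^{r\times r}$, $R\in\mathbb R^{p\times r}$, and $N$ followers $$x_i(k+1)=\bar A_ix_i(k)+\bar B_iu_i(k)+\bar E_iw_i(k),\qquad y_i(k)=C_ix_i(k)+D_iu_i(k),\qquad i=1,\dots,N,$$ with state $x_i\in\mathbb R^{n_i}$ ($n_i\ge 1$), input $u_i\in\mathbb R^{m_i}$, disturbance $w_i\in\mathbb R^{q_i}$, known $C_i,D_i$ and unknown $\bar A_i,\bar B_i,\bar E_i$. On the time interval $\{0,\dots,\tau\}$ each follower has generated the data $U_{i-}=[u_i(0)\ \cdots\ u_i(\tau-1)]$, $W_{i-}=[w_i(0)\ \cdots\ w_i(\tau-1)]$, $X_i=[x_i(0)\ \cdots\ x_i(\tau)]$; put $X_{i-}=[x_i(0)\ \cdots\ x_i(\tau-1)]$ and $X_{i+}=[x_i(1)\ \cdots\ x_i(\tau)]$. Let $$\Sigma_{w,i}=\{(A_i,B_i,E_i)\mid X_{i+}=A_iX_{i-}+B_iU_{i-}+E_iW_{i-}\}$$ be the set of systems that explain the data of follower $i$;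 thus $(\bar A_i,\bar B_i,\bar E_i)\in\Sigma_{w,i}$. A square matrix is called stable if all its complex eigenvalues have modulus less than $1$. Let $\mathcal A=[a_{ij}]$ be the adjacency matrix, with nonnegative entries, of the communication graph between the followers: $a_{ij}\neq0$ if and only if there is an edge from $j$ to $i$. Let $d_i=\sum_ja_{ij}$, $\mathcal D=\mathrm{diag}(d_1,\dots,d_N)$, $L=\mathcal D-\mathcal A$, and $G=\mathrm{diag}(g_1,\dots,g_N)$, where $g_i\ge0$, and $g_i>0$ means that the leader shares its state with follower $i$. Assume: 1. all eigenvalues of $S$ are simple and lie on the unit circle; 2. the graph has no self-loops and contains a (directed) spanning tree, and $g_i>0$ for at least one node $i$ that is the root of a spanning tree. A protocol consists of matrices $F$ and $K_i,\Pi_i,\Gamma_i$ ($i=1,\dots,N$) and is given by $$v_i(k+1)=Sv_i(k)+(1+d_i+g_i)^{-1}F\Big(\sum_{j=1}^Na_{ij}(v_j(k)-v_i(k))+g_i(x_r(k)-v_i(k))\Big),$$ $$u_i(k)=K_i(x_i(k)-\Pi_iv_i(k))+\Gamma_iv_i(k).$$ It achieves output synchronization for given follower systems $(A_i,B_i,E_i)$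 if the interconnection of the leader, the protocol and the followers $x_i(k+1)=A_ix_i(k)+B_iu_i(k)$ (that is, operated with $w_i=0$) satisfies $y_i(k)-y_r(k)\to0$, $v_i(k)-x_r(k)\to0$ and $x_i(k)-\Pi_iv_i(k)\to0$ as $k\to\infty$, for all $i$ and all initial states. The data $(U_{i-},W_{i-},X_i)$ are informative for output synchronization if there is one protocol that achieves output synchronization for all choices of systems $(A_i,B_i,E_i)\in\Sigma_{w,i}$, $i=1,\dots,N$. **Theorem.** The data $(U_{i-},W_{i-},X_i)$ are informative for output synchronization if and only if, for $i=1,\dots,N$, the following two statements hold: (i) there exists a right inverse $X_{i-}^\dagger$ of $X_{i-}$ such that $X_{i+}X_{i-}^\dagger$ is stable and $W_{i-}X_{i-}^\dagger=0$; (ii) there exists a matrix $M_i$ such that $X_{i+}M_i-X_{i-}M_iS=0$, $W_{i-}M_i=0$ and $C_iX_{i-}M_i+D_iU_{i-}M_i=R$. In this case a protocol that achieves output synchronization for all systems explaining the data is obtained as follows: take any $F$ such that $S-\lambda F$ is stable for every eigenvalue $\lambda$ of $(I_N+\mathcal D+G)^{-1}(L+G)$ (such an $F$ exists), and, for any $X_{i-}^\dagger$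 as in (i) and any $M_i$ as in (ii), put $K_i=U_{i-}X_{i-}^\dagger$, $\Pi_i=X_{i-}M_i$ and $\Gamma_i=U_{i-}M_i$. -/

import Mathlib

open scoped Matrix

noncomputable section

namespace OutputSync

/-! ### Matrices -/

/-- A real matrix regarded as a complex one. -/
def toC {k l : ℕ} (A : Matrix (Fin k) (Fin l) ℝ) : Matrix (Fin k) (Fin l) ℂ :=
  A.map (fun x : ℝ => (x : ℂ))

/-- Schur stability: all eigenvalues lie in the open unit disc. -/
def SchurStable {k : ℕ} (A : Matrix (Fin k) (Fin k) ℂ) : Prop :=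
  ∀ z ∈ spectrum ℂ A, ‖z‖ < 1

/-- All (complex) eigenvalues of `S` are simple and lie on the unit circle. -/
def SimpleUnitCircleSpectrum {r : ℕ} (S : Matrix (Fin r) (Fin r) ℝ) : Prop :=
  ∀ z ∈ spectrum ℂ (toC S), ‖z‖ = 1 ∧ (toC S).charpoly.rootMultiplicity z = 1

/-! ### The communication graph

The graph between the `N` followers is given by its adjacency matrix `a` with nonnegative entries;
`a j i` is the weight of the edge from `i` to `j`. The vector `g` holds the leader's weights. -/

/-- There is an edge from `i` to `j`. -/
def Edge {N : ℕ} (a : Matrix (Fin N) (Fin N) ℝ) (i j : Fin N) : Prop := a j i ≠ 0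

/-- The graph has no self-loops. -/
def IsSimple {N : ℕ} (a : Matrix (Fin N) (Fin N) ℝ) : Prop := ∀ i, a i i = 0

/-- `T` is (the edge relation of) a spanning tree with the given root of the graph whose edge
relation is `E`. -/
structure IsSpanningTree {N : ℕ} (E T : Fin N → Fin N → Prop) (root : Fin N) : Prop where
  isSubgraph : ∀ i j, T i j → E i j
  root_inDegree : ∀ i, ¬ T i root
  inDegree : ∀ j, j ≠ root → ∃! i, T i j
  connects : ∀ j, Relation.ReflTransGen T root j

/-- The node `i` is a root node: it is the root of some spanning tree. -/
def IsRootNode {N : ℕ} (a : Matrix (Fin N) (Fin N) ℝ) (i : Fin N) : Prop :=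
  ∃ T : Fin N → Fin N → Prop, IsSpanningTree (Edge a) T i

/-- The followers' graph is simple and contains a spanning tree, and the leader shares its
information with at least one of the root nodes. -/
def GraphAssumption {N : ℕ} (a : Matrix (Fin N) (Fin N) ℝ) (g : Fin N → ℝ) : Prop :=
  IsSimple a ∧ (∃ i, IsRootNode a i) ∧ ∃ i, IsRootNode a i ∧ 0 < g i

/-- The node degree `d_i = ∑ j, a_ij`. -/
def degree {N : ℕ} (a : Matrix (Fin N) (Fin N) ℝ) (i : Fin N) : ℝ := ∑ j, a i j

/-- The Laplacian matrix. -/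
def laplacian {N : ℕ} (a : Matrix (Fin N) (Fin N) ℝ) : Matrix (Fin N) (Fin N) ℝ :=
  Matrix.diagonal (degree a) - a

/-- The matrix `(I + 𝒟 + G)⁻¹ (L + G)`. -/
def couplingMatrix {N : ℕ} (a : Matrix (Fin N) (Fin N) ℝ) (g : Fin N → ℝ) :
    Matrix (Fin N) (Fin N) ℝ :=
  (1 + Matrix.diagonal (degree a) + Matrix.diagonal g)⁻¹ * (laplacian a + Matrix.diagonal g)

/-- `S - z F` is stable for every eigenvalue `z` of `(I + 𝒟 + G)⁻¹ (L + G)`. -/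
def SimultaneouslyStabilizes {N r : ℕ} (a : Matrix (Fin N) (Fin N) ℝ) (g : Fin N → ℝ)
    (S F : Matrix (Fin r) (Fin r) ℝ) : Prop :=
  ∀ z ∈ spectrum ℂ (toC (couplingMatrix a g)), SchurStable (toC S - z • toC F)

/-! ### Follower systems and data -/

/-- A follower system `x(k+1) = A x(k) + B u(k) + E w(k)`. -/
structure FollowerSystem (n m q : ℕ) where
  A : Matrix (Fin n) (Fin n) ℝ
  B : Matrix (Fin n) (Fin m) ℝ
  E : Matrix (Fin n) (Fin q) ℝ

/-- Measured data of a follower; the columns are the samples of the input and of the disturbance at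
times `0, …, τ - 1` and of the state at times `0, …, τ`. -/
structure FollowerData (n m q τ : ℕ) where
  U : Matrix (Fin m) (Fin τ) ℝ
  W : Matrix (Fin q) (Fin τ) ℝ
  X : Matrix (Fin n) (Fin (τ + 1)) ℝ

/-- The states at times `0, …, τ - 1`. -/
def FollowerData.Xminus {n m q τ : ℕ} (d : FollowerData n m q τ) : Matrix (Fin n) (Fin τ) ℝ :=
  d.X.submatrix id Fin.castSucc

/-- The states at times `1, …, τ`. -/
def FollowerData.Xplus {n m q τ : ℕ} (d : FollowerData n m q τ) : Matrix (Fin n) (Fin τ) ℝ :=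
  d.X.submatrix id Fin.succ

/-- The set of all systems that explain the data. -/
def FollowerData.systems {n m q τ : ℕ} (d : FollowerData n m q τ) :
    Set (FollowerSystem n m q) :=
  {s | d.Xplus = s.A * d.Xminus + s.B * d.U + s.E * d.W}

/-- `Xd` is a right inverse of `X₋` such that `X₊ Xd` is stable and `W₋ Xd = 0`. -/
def FollowerData.IsStabilizingRightInverse {n m q τ : ℕ} (d : FollowerData n m q τ)
    (Xd : Matrix (Fin τ) (Fin n) ℝ) : Prop :=
  d.Xminus * Xd = 1 ∧ SchurStable (toC (d.Xplus * Xd)) ∧ d.W * Xd = 0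

/-- `M` satisfies the linear equations `X₊ M - X₋ M S = 0`, `W₋ M = 0`, `C X₋ M + D U₋ M = R`. -/
def FollowerData.SolvesLinearEquations {n m q τ r p : ℕ} (d : FollowerData n m q τ)
    (S : Matrix (Fin r) (Fin r) ℝ) (R : Matrix (Fin p) (Fin r) ℝ)
    (C : Matrix (Fin p) (Fin n) ℝ) (D : Matrix (Fin p) (Fin m) ℝ)
    (M : Matrix (Fin τ) (Fin r) ℝ) : Prop :=
  d.Xplus * M - d.Xminus * M * S = 0 ∧ d.W * M = 0 ∧ C * d.Xminus * M + D * d.U * M = R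

/-! ### Protocols and output synchronization -/

/-- The gains of a distributed protocol. -/
structure Protocol {N : ℕ} (n m : Fin N → ℕ) (r : ℕ) where
  F : Matrix (Fin r) (Fin r) ℝ
  K : ∀ i, Matrix (Fin (m i)) (Fin (n i)) ℝ
  Pi : ∀ i, Matrix (Fin (n i)) (Fin r) ℝ
  Gam : ∀ i, Matrix (Fin (m i)) (Fin r) ℝ

/-- The control input `u_i = K_i (x_i - Π_i v_i) + Γ_i v_i`. -/
def Protocol.input {N r : ℕ} {n m : Fin N → ℕ} (P : Protocol n m r) (i : Fin N)
    (x : Fin (n i) → ℝ) (v : Fin r → ℝ) : Fin (m i) → ℝ :=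
  P.K i *ᵥ (x - P.Pi i *ᵥ v) + P.Gam i *ᵥ v

/-- `(xr, v, x)` is a trajectory of the leader, the local controllers and the followers, when the
followers are the systems `sys`, interconnected by the protocol `P`, with disturbances `w`. -/
structure IsTrajectory {N r : ℕ} {n m q : Fin N → ℕ} (S : Matrix (Fin r) (Fin r) ℝ)
    (a : Matrix (Fin N) (Fin N) ℝ) (g : Fin N → ℝ)
    (sys : ∀ i, FollowerSystem (n i) (m i) (q i)) (P : Protocol n m r)
    (w : ∀ i, ℕ → Fin (q i) → ℝ)
    (xr : ℕ → Fin r → ℝ) (v : Fin N → ℕ → Fin r → ℝ) (x : ∀ i, ℕ → Fin (n i) → ℝ) : Prop where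
  leader : ∀ k, xr (k + 1) = S *ᵥ xr k
  controller : ∀ i k, v i (k + 1) = S *ᵥ v i k + (1 + degree a i + g i)⁻¹ •
    (P.F *ᵥ (∑ j, a i j • (v j k - v i k) + g i • (xr k - v i k)))
  follower : ∀ i k, x i (k + 1) =
    (sys i).A *ᵥ x i k + (sys i).B *ᵥ P.input i (x i k) (v i k) + (sys i).E *ᵥ w i k

/-- The protocol `P` achieves output synchronization for the leader and the followers `sys`: for all
initial states, in the absence of disturbances, `y_i - y_r → 0`, `v_i - x_r → 0` and
`x_i - Π_i v_i → 0`, where `y_r = R x_r` and `y_i = C_i x_i + D_i u_i`. -/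
def AchievesOutputSync {N r p : ℕ} {n m q : Fin N → ℕ} (S : Matrix (Fin r) (Fin r) ℝ)
    (R : Matrix (Fin p) (Fin r) ℝ) (C : ∀ i, Matrix (Fin p) (Fin (n i)) ℝ)
    (D : ∀ i, Matrix (Fin p) (Fin (m i)) ℝ) (a : Matrix (Fin N) (Fin N) ℝ) (g : Fin N → ℝ)
    (sys : ∀ i, FollowerSystem (n i) (m i) (q i)) (P : Protocol n m r) : Prop :=
  ∀ (xr : ℕ → Fin r → ℝ) (v : Fin N → ℕ → Fin r → ℝ) (x : ∀ i, ℕ → Fin (n i) → ℝ),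
    IsTrajectory S a g sys P (fun _ _ => 0) xr v x →
    ∀ i,
      Filter.Tendsto (fun k => C i *ᵥ x i k + D i *ᵥ P.input i (x i k) (v i k) - R *ᵥ xr k)
        Filter.atTop (nhds 0) ∧
      Filter.Tendsto (fun k => v i k - xr k) Filter.atTop (nhds 0) ∧
      Filter.Tendsto (fun k => x i k - P.Pi i *ᵥ v i k) Filter.atTop (nhds 0)

/-- The protocol `P` achieves output synchronization for all followers that explain the data. -/
def AchievesOutputSyncForData {N r p τ : ℕ} {n m q : Fin N → ℕ} (S : Matrix (Fin r) (Fin r) ℝ)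
    (R : Matrix (Fin p) (Fin r) ℝ) (C : ∀ i, Matrix (Fin p) (Fin (n i)) ℝ)
    (D : ∀ i, Matrix (Fin p) (Fin (m i)) ℝ) (a : Matrix (Fin N) (Fin N) ℝ) (g : Fin N → ℝ)
    (data : ∀ i, FollowerData (n i) (m i) (q i) τ) (P : Protocol n m r) : Prop :=
  ∀ sys : ∀ i, FollowerSystem (n i) (m i) (q i),
    (∀ i, sys i ∈ (data i).systems) → AchievesOutputSync S R C D a g sys P

/-- The data are informative for output synchronization. -/
def InformativeForOutputSync {N r p τ : ℕ} {n m q : Fin N → ℕ} (S : Matrix (Fin r) (Fin r) ℝ)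
    (R : Matrix (Fin p) (Fin r) ℝ) (C : ∀ i, Matrix (Fin p) (Fin (n i)) ℝ)
    (D : ∀ i, Matrix (Fin p) (Fin (m i)) ℝ) (a : Matrix (Fin N) (Fin N) ℝ) (g : Fin N → ℝ)
    (data : ∀ i, FollowerData (n i) (m i) (q i) τ) : Prop :=
  ∃ P : Protocol n m r, AchievesOutputSyncForData S R C D a g data P

end OutputSync

end

/-! The errors of the local controllers, stacked into one vector, evolve with `1 ⊗ S - H ⊗ F`, where
`H` is the coupling matrix, and drive the local loops `A_i + B_i K_i`. Since `H ⊗ 1` commutes with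
`1 ⊗ S - H ⊗ F`, a common eigenvector shows that every eigenvalue of the latter is one of some
`S - λ F` with `λ` an eigenvalue of `H`. By the maximum principle `1 - H` is Schur stable, so
`F = S` stabilizes all of them when the spectral radius of `S` is at most one.

Conversely, following trajectories along which the controllers agree with the leader, a protocol
that synchronizes must stabilize every system that explains the data and solve its regulator
equations. Two such systems differ by a solution `(A₀, B₀, E₀)` of the homogeneous equation
`A₀ X₋ + B₀ U₋ + E₀ W₋ = 0`. Hence `A₀ Π + B₀ Γ = 0`, and also `A₀ + B₀ K = 0`: scaling the
perturbation by `t (A₀ + B₀ K)ᵀ` would otherwise make the trace of a stable matrix unbounded. So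
every functional that vanishes on the columns of the data `(X₋, U₋, W₋)` vanishes on the columns of
`(1, K, 0)` and `(Π, Γ, 0)`; these are therefore combinations of data columns, with coefficients
`X₋†` and `M`. -/

namespace OutputSync

open Filter Topology Relation
open scoped Kronecker

section Banach

variable {A : Type*} [NormedRing A] [NormedAlgebra ℂ A] [CompleteSpace A]

theorem tendsto_pow_of_spectralRadius_lt_one {x : A} (hx : spectralRadius ℂ x < 1) :
    Tendsto (fun k => x ^ k) atTop (𝓝 0) := by
  obtain ⟨c, hxc, hc⟩ := ENNReal.lt_iff_exists_nnreal_btwn.mp hx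
  have hroot : ∀ᶠ k : ℕ in atTop, (‖x ^ k‖₊ : ENNReal) ^ (1 / k : ℝ) < c :=
    (spectrum.pow_nnnorm_pow_one_div_tendsto_nhds_spectralRadius x).eventually_lt_const hxc
  refine squeeze_zero_norm' ?_ (tendsto_pow_atTop_nhds_zero_of_lt_one c.coe_nonneg
    (by exact_mod_cast hc))
  filter_upwards [hroot, eventually_gt_atTop 0] with k hk hk0
  rw [one_div, ENNReal.rpow_inv_lt_iff (by positivity), ENNReal.rpow_natCast] at hk
  exact_mod_cast hk.le

theorem tendsto_pow_iff_forall_spectrum_norm_lt_one {x : A} :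
    Tendsto (fun k => x ^ k) atTop (𝓝 0) ↔ ∀ z ∈ spectrum ℂ x, ‖z‖ < 1 := by
  refine ⟨fun h z hz => ?_, fun h => ?_⟩
  · have hle : ∀ k, ‖z‖ ^ k ≤ ‖x ^ k‖ * ‖(1 : A)‖ := fun k => by
      rw [← norm_pow]
      exact spectrum.norm_le_norm_mul_of_mem (spectrum.pow_mem_pow x k hz)
    have hzero : Tendsto (fun k => ‖x ^ k‖ * ‖(1 : A)‖) atTop (𝓝 0) := by
      simpa using h.norm.mul_const ‖(1 : A)‖
    rw [← abs_norm, ← tendsto_pow_atTop_nhds_zero_iff]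
    exact squeeze_zero (fun k => by positivity) hle hzero
  · nontriviality A
    exact tendsto_pow_of_spectralRadius_lt_one <|
      spectrum.spectralRadius_lt_of_forall_lt (r := 1) x fun z hz => by exact_mod_cast h z hz

end Banach

section Eigenvectors

variable {K V : Type*} [Field K] [AddCommGroup V] [Module K V]

theorem exists_hasEigenvector_of_commute [IsAlgClosed K] [FiniteDimensional K V]
    {f g : Module.End K V} (hfg : Commute f g) {μ : K} (hμ : f.HasEigenvalue μ) :
    ∃ ν w, f.HasEigenvector μ w ∧ g.HasEigenvector ν w := by
  have hinv : Set.MapsTo g (f.eigenspace μ) (f.eigenspace μ) :=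
    Module.End.mapsTo_genEigenspace_of_comm hfg μ 1
  have : Nontrivial (f.eigenspace μ) := Submodule.nontrivial_iff_ne_bot.mpr hμ
  obtain ⟨ν, hν⟩ := Module.End.exists_eigenvalue (g.restrict hinv)
  obtain ⟨w, hw⟩ := hν.exists_hasEigenvector
  have hw0 : (w : V) ≠ 0 := fun h => hw.2 (Subtype.ext h)
  exact ⟨ν, w, ⟨w.2, hw0⟩,
    Module.End.mem_eigenspace_iff.mpr (congrArg Subtype.val hw.apply_eq_smul), hw0⟩

end Eigenvectors

-- The vectors with vanishing orbits form an invariant subspace; if it were nonzero, `f` would have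
-- an eigenvector there.
theorem eq_zero_of_tendsto_pow_apply {V : Type*} [NormedAddCommGroup V] [NormedSpace ℂ V]
    [FiniteDimensional ℂ V] {f : Module.End ℂ V} (hf : ∀ z, f.HasEigenvalue z → 1 ≤ ‖z‖) {x : V}
    (hx : Tendsto (fun k => (f ^ k) x) atTop (𝓝 0)) : x = 0 := by
  let W : Submodule ℂ V :=
    { carrier := {y | Tendsto (fun k => (f ^ k) y) atTop (𝓝 0)}
      zero_mem' := by simp
      add_mem' := fun hy hz => by simpa using hy.add hz
      smul_mem' := fun c y hy => by simpa using hy.const_smul c }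
  have hinv : Set.MapsTo f W W := fun y (hy : Tendsto _ _ _) =>
    ((tendsto_add_atTop_iff_nat 1).mpr hy).congr fun k => by rw [pow_succ, Module.End.mul_apply]
  suffices Subsingleton W from congrArg Subtype.val (Subsingleton.elim (⟨x, hx⟩ : W) 0)
  by_contra hW
  rw [not_subsingleton_iff_nontrivial] at hW
  obtain ⟨z, hz⟩ := Module.End.exists_eigenvalue (f.restrict hinv)
  obtain ⟨w, hw⟩ := hz.exists_hasEigenvector
  have hw0 : (w : V) ≠ 0 := fun h => hw.2 (Subtype.ext h)
  have hfw : f.HasEigenvector z w :=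
    ⟨Module.End.mem_eigenspace_iff.mpr (congrArg Subtype.val hw.apply_eq_smul), hw0⟩
  have hdecay : Tendsto (fun k => z ^ k • (w : V)) atTop (𝓝 0) :=
    Tendsto.congr (fun k => hfw.pow_apply k) w.2
  have hle : ∀ k, ‖(w : V)‖ ≤ ‖z ^ k • (w : V)‖ := fun k => by
    rw [norm_smul, norm_pow]
    exact le_mul_of_one_le_left (norm_nonneg _)
      (one_le_pow₀ (hf z (Module.End.hasEigenvalue_of_hasEigenvector hfw)))
  exact hw0 (norm_le_zero_iff.mp (ge_of_tendsto' (norm_zero (E := V) ▸ hdecay.norm) hle))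

section Spectrum

variable {K ι κ : Type*} [Field K] [Fintype ι] [DecidableEq ι]

theorem mem_spectrum_of_mul_eq_smul {A : Matrix ι ι K} {X : Matrix ι κ K} {z : K} (hX : X ≠ 0)
    (h : A * X = z • X) : z ∈ spectrum K A := by
  rw [spectrum.mem_iff]
  rintro ⟨u, hu⟩
  have h0 : (u : Matrix ι ι K) * X = 0 := by
    rw [hu, Matrix.sub_mul, h, Algebra.algebraMap_eq_smul_one, Matrix.smul_mul, Matrix.one_mul,
      sub_self]
  refine hX ?_
  rw [← Matrix.one_mul X, ← u.inv_mul, Matrix.mul_assoc, h0, Matrix.mul_zero]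

theorem spectrum_transpose (A : Matrix ι ι K) : spectrum K Aᵀ = spectrum K A := by
  ext z
  simp only [Matrix.mem_spectrum_iff_isRoot_charpoly, Matrix.charpoly_transpose]

theorem mem_spectrum_of_mul_eq_smul' {A : Matrix ι ι K} {X : Matrix κ ι K} {z : K} (hX : X ≠ 0)
    (h : X * A = z • X) : z ∈ spectrum K A := by
  rw [← spectrum_transpose]
  refine mem_spectrum_of_mul_eq_smul (X := Xᵀ) (by simpa using hX) ?_
  rw [← Matrix.transpose_mul, h, Matrix.transpose_smul]

variable [Fintype κ] [DecidableEq κ]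

-- A common eigenvector `vec X` of `1 ⊗ S - H ⊗ F` and `H ⊗ 1` satisfies `S X - F X Hᵀ = z X` and
-- `X Hᵀ = l X`, so the nonzero columns of `X` are eigenvectors of `S - l F`.
theorem exists_mem_spectrum_of_mem_spectrum_kronecker_sub [IsAlgClosed K] {S F : Matrix ι ι K}
    {H : Matrix κ κ K} {z : K} (hz : z ∈ spectrum K ((1 : Matrix κ κ K) ⊗ₖ S - H ⊗ₖ F)) :
    ∃ l ∈ spectrum K H, z ∈ spectrum K (S - l • F) := by
  have hcomm : Commute ((1 : Matrix κ κ K) ⊗ₖ S - H ⊗ₖ F) (H ⊗ₖ (1 : Matrix ι ι K)) := by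
    rw [Commute, SemiconjBy, Matrix.sub_mul, Matrix.mul_sub]
    simp only [← Matrix.mul_kronecker_mul, Matrix.one_mul, Matrix.mul_one]
  rw [← Matrix.spectrum_toLin', ← Module.End.hasEigenvalue_iff_mem_spectrum] at hz
  obtain ⟨l, w, hw, hl⟩ :=
    exists_hasEigenvector_of_commute (hcomm.map (Matrix.toLinAlgEquiv' (R := K))) hz
  obtain ⟨X, rfl⟩ := Matrix.vec_bijective.surjective w
  have hX : X ≠ 0 := by simpa only [ne_eq, Matrix.vec_eq_zero_iff] using hw.2
  have hXH : X * Hᵀ = l • X := by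
    have hvec : (H ⊗ₖ (1 : Matrix ι ι K)) *ᵥ X.vec = l • X.vec := hl.apply_eq_smul
    rwa [Matrix.kronecker_mulVec_vec, Matrix.one_mul, ← Matrix.vec_smul, Matrix.vec_inj] at hvec
  have hSX : S * X - F * (X * Hᵀ) = z • X := by
    have hvec : ((1 : Matrix κ κ K) ⊗ₖ S - H ⊗ₖ F) *ᵥ X.vec = z • X.vec := hw.apply_eq_smul
    rwa [Matrix.sub_mulVec, Matrix.kronecker_mulVec_vec, Matrix.kronecker_mulVec_vec,
      Matrix.transpose_one, Matrix.mul_one, Matrix.mul_assoc, ← Matrix.vec_sub, ← Matrix.vec_smul,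
      Matrix.vec_inj] at hvec
  refine ⟨l, spectrum_transpose H ▸ mem_spectrum_of_mul_eq_smul' hX hXH,
    mem_spectrum_of_mul_eq_smul hX ?_⟩
  rw [Matrix.sub_mul, Matrix.smul_mul, ← Matrix.mul_smul, ← hXH, hSX]

theorem norm_lt_one_of_mem_spectrum_smul {A : Matrix ι ι ℂ}
    (hA : ∀ z ∈ spectrum ℂ A, ‖z‖ ≤ 1) {c : ℂ} (hc : ‖c‖ < 1) {z : ℂ}
    (hz : z ∈ spectrum ℂ (c • A)) : ‖z‖ < 1 := by
  cases isEmpty_or_nonempty ι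
  · simp at hz
  rw [spectrum.smul_eq_smul _ _ (spectrum.nonempty_of_isAlgClosed_of_finiteDimensional ℂ A)] at hz
  obtain ⟨w, hw, rfl⟩ := hz
  calc ‖c • w‖ = ‖c‖ * ‖w‖ := norm_smul c w
    _ ≤ ‖c‖ := mul_le_of_le_one_right (norm_nonneg c) (hA w hw)
    _ < 1 := hc

theorem norm_trace_le_of_forall_spectrum {A : Matrix ι ι ℂ} {c : ℝ}
    (hA : ∀ z ∈ spectrum ℂ A, ‖z‖ ≤ c) : ‖A.trace‖ ≤ Fintype.card ι * c := by
  have hcard : A.charpoly.roots.card = Fintype.card ι := by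
    rw [← (IsAlgClosed.splits A.charpoly).natDegree_eq_card_roots,
      Matrix.charpoly_natDegree_eq_dim]
  calc ‖A.trace‖ = ‖A.charpoly.roots.sum‖ := by rw [Matrix.trace_eq_sum_roots_charpoly]
    _ ≤ (A.charpoly.roots.map fun z => ‖z‖).sum := norm_multiset_sum_le _
    _ ≤ (A.charpoly.roots.map fun z => ‖z‖).card • c := by
      refine Multiset.sum_le_card_nsmul _ _ (Multiset.forall_mem_map_iff.mpr fun z hz => ?_)
      exact hA z (Matrix.mem_spectrum_iff_isRoot_charpoly.mpr (Polynomial.isRoot_of_mem_roots hz))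
    _ = Fintype.card ι * c := by rw [Multiset.card_map, hcard, nsmul_eq_mul]

theorem exists_mul_eq_of_forall_vecMul {α β γ : Type*} [Fintype α] [Fintype β]
    {D : Matrix α β K} {Y : Matrix α γ K} (h : ∀ f, f ᵥ* D = 0 → f ᵥ* Y = 0) :
    ∃ M : Matrix β γ K, D * M = Y := by
  classical
  have hcol : ∀ j, LinearMap.proj j ∘ₗ Y.vecMulLinear ∈
      Submodule.span K (Set.range fun i => LinearMap.proj i ∘ₗ D.vecMulLinear) := fun j =>
    mem_span_of_iInf_ker_le_ker fun f hf => congrFun (h f (funext fun i => by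
      simpa using (Submodule.mem_iInf _).mp hf i)) j
  simp only [Submodule.mem_span_range_iff_exists_fun] at hcol
  choose m hm using hcol
  refine ⟨Matrix.of fun i j => m j i, ?_⟩
  ext e j
  simpa [Matrix.mul_apply, mul_comm] using LinearMap.congr_fun (hm j) (Pi.single e 1)

end Spectrum

section Decay

variable {ι κ : Type*}

theorem tendsto_zero_iff_forall_apply {R : Type*} [TopologicalSpace R] [Zero R]
    {A : ℕ → Matrix ι κ R} :
    Tendsto A atTop (𝓝 0) ↔ ∀ i j, Tendsto (fun k => A k i j) atTop (𝓝 0) :=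
  tendsto_pi_nhds.trans (forall_congr' fun _ => tendsto_pi_nhds)

theorem tendsto_map_ofReal_iff {A : ℕ → Matrix ι κ ℝ} :
    Tendsto (fun k => (A k).map Complex.ofRealHom) atTop (𝓝 0) ↔ Tendsto A atTop (𝓝 0) := by
  simp only [tendsto_zero_iff_forall_apply, Matrix.map_apply, Complex.ofRealHom_eq_coe,
    ← Complex.ofReal_zero, tendsto_ofReal_iff]

variable [Fintype κ]

theorem tendsto_mulVec_zero (A : Matrix ι κ ℝ) {x : ℕ → κ → ℝ} (hx : Tendsto x atTop (𝓝 0)) :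
    Tendsto (fun k => A *ᵥ x k) atTop (𝓝 0) := by
  have hA : Continuous fun y : κ → ℝ => A *ᵥ y := continuous_const.matrix_mulVec continuous_id
  exact (hA.tendsto' 0 0 (Matrix.mulVec_zero A)).comp hx

theorem tendsto_zero_iff_forall_mulVec {A : ℕ → Matrix ι κ ℝ} :
    Tendsto A atTop (𝓝 0) ↔ ∀ v, Tendsto (fun k => A k *ᵥ v) atTop (𝓝 0) := by
  classical
  refine ⟨fun h v => ?_, fun h => tendsto_zero_iff_forall_apply.mpr fun i j => ?_⟩
  · have hv : Continuous fun B : Matrix ι κ ℝ => B *ᵥ v :=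
      continuous_id.matrix_mulVec continuous_const
    exact (hv.tendsto' 0 0 (Matrix.zero_mulVec v)).comp h
  · simpa using tendsto_pi_nhds.mp (h (Pi.single j 1)) i

end Decay

section Schur

open scoped Matrix.Norms.L2Operator

variable {ι κ : Type*} [Fintype ι] [DecidableEq ι]

/-- Schur stability of a real square matrix over an arbitrary finite index type; for `Fin k` this
unfolds to `SchurStable (toC A)`. The closed loop is indexed by products and sums of types. -/
def IsSchur (A : Matrix ι ι ℝ) : Prop := ∀ z ∈ spectrum ℂ (A.map Complex.ofRealHom), ‖z‖ < 1

theorem isSchur_iff_tendsto_pow {A : Matrix ι ι ℝ} :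
    IsSchur A ↔ Tendsto (fun k => A ^ k) atTop (𝓝 0) := by
  rw [IsSchur, ← tendsto_pow_iff_forall_spectrum_norm_lt_one, ← tendsto_map_ofReal_iff]
  have hmap : ∀ k, (A ^ k).map Complex.ofRealHom = A.map Complex.ofRealHom ^ k :=
    map_pow Complex.ofRealHom.mapMatrix A
  simp only [hmap]

theorem pow_mulVec_eq_of_recursion {A : Matrix ι ι ℝ} {x : ℕ → ι → ℝ}
    (hx : ∀ k, x (k + 1) = A *ᵥ x k) (k : ℕ) : A ^ k *ᵥ x 0 = x k := by
  induction k with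
  | zero => rw [pow_zero, Matrix.one_mulVec]
  | succ k ih => rw [hx, ← ih, Matrix.mulVec_mulVec, pow_succ']

theorem IsSchur.tendsto_of_recursion {A : Matrix ι ι ℝ} (hA : IsSchur A) {x : ℕ → ι → ℝ}
    (hx : ∀ k, x (k + 1) = A *ᵥ x k) : Tendsto x atTop (𝓝 0) :=
  (tendsto_zero_iff_forall_mulVec.mp (isSchur_iff_tendsto_pow.mp hA) (x 0)).congr
    (pow_mulVec_eq_of_recursion hx)

theorem IsSchur.one_kronecker_sub [Fintype κ] [DecidableEq κ] {S F : Matrix ι ι ℝ}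
    {H : Matrix κ κ ℝ}
    (h : ∀ l ∈ spectrum ℂ (H.map Complex.ofRealHom),
      ∀ z ∈ spectrum ℂ (S.map Complex.ofRealHom - l • F.map Complex.ofRealHom), ‖z‖ < 1) :
    IsSchur ((1 : Matrix κ κ ℝ) ⊗ₖ S - H ⊗ₖ F) := fun z hz => by
  have hmap : ((1 : Matrix κ κ ℝ) ⊗ₖ S - H ⊗ₖ F).map Complex.ofRealHom =
      (1 : Matrix κ κ ℂ) ⊗ₖ S.map Complex.ofRealHom -
        H.map Complex.ofRealHom ⊗ₖ F.map Complex.ofRealHom := by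
    ext a b
    simp [Matrix.one_apply, apply_ite Complex.ofReal]
  rw [hmap] at hz
  obtain ⟨l, hl, hzl⟩ := exists_mem_spectrum_of_mem_spectrum_kronecker_sub hz
  exact h l hl z hzl

theorem IsSchur.fromBlocks_zero₁₂ [Fintype κ] [DecidableEq κ] {A : Matrix ι ι ℝ}
    {B : Matrix κ κ ℝ} (hA : IsSchur A) (hB : IsSchur B) (L : Matrix κ ι ℝ) :
    IsSchur (Matrix.fromBlocks A 0 L B) := fun z hz => by
  rw [Matrix.fromBlocks_map, Matrix.map_zero _ (map_zero _),
    Matrix.mem_spectrum_iff_isRoot_charpoly, Matrix.charpoly_fromBlocks_zero₁₂,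
    Polynomial.root_mul] at hz
  exact hz.elim (fun h => hA z (Matrix.mem_spectrum_iff_isRoot_charpoly.mpr h))
    fun h => hB z (Matrix.mem_spectrum_iff_isRoot_charpoly.mpr h)

theorem IsSchur.tendsto_of_cascade [Fintype κ] [DecidableEq κ] {A : Matrix ι ι ℝ}
    {B : Matrix κ κ ℝ} (hA : IsSchur A) (hB : IsSchur B) (L : Matrix κ ι ℝ) {x : ℕ → ι → ℝ}
    {y : ℕ → κ → ℝ}
    (hx : ∀ k, x (k + 1) = A *ᵥ x k) (hy : ∀ k, y (k + 1) = L *ᵥ x k + B *ᵥ y k) :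
    Tendsto y atTop (𝓝 0) := by
  have hxy : Tendsto (fun k => Sum.elim (x k) (y k)) atTop (𝓝 0) :=
    (hA.fromBlocks_zero₁₂ hB L).tendsto_of_recursion fun k => by
      rw [hx, hy, Matrix.fromBlocks_mulVec]
      simp
  exact tendsto_pi_nhds.mpr fun i => tendsto_pi_nhds.mp hxy (Sum.inr i)

theorem eq_zero_of_tendsto_mul_pow [Finite κ] {S : Matrix ι ι ℝ}
    (hS : ∀ z ∈ spectrum ℂ (S.map Complex.ofRealHom), 1 ≤ ‖z‖) {Z : Matrix κ ι ℝ}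
    (hZ : Tendsto (fun k => Z * S ^ k) atTop (𝓝 0)) : Z = 0 := by
  cases nonempty_fintype κ
  let f : Module.End ℂ (Matrix κ ι ℂ) := mulRightLinearMap κ ℂ (S.map Complex.ofRealHom)
  have hf : ∀ z, f.HasEigenvalue z → 1 ≤ ‖z‖ := fun z hz => by
    obtain ⟨X, hX⟩ := hz.exists_hasEigenvector
    exact hS z (mem_spectrum_of_mul_eq_smul' hX.2 hX.apply_eq_smul)
  have hpow : ∀ k, (Z * S ^ k).map Complex.ofRealHom = (f ^ k) (Z.map Complex.ofRealHom) := by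
    intro k
    induction k with
    | zero => simp
    | succ k ih =>
      rw [pow_succ, pow_succ', ← Matrix.mul_assoc, Matrix.map_mul, ih]
      rfl
  have h0 := eq_zero_of_tendsto_pow_apply hf ((tendsto_map_ofReal_iff.mpr hZ).congr hpow)
  exact Matrix.map_injective Complex.ofRealHom.injective
    (h0.trans (Matrix.map_zero _ (map_zero _)).symm)

theorem eq_zero_of_forall_tendsto_mulVec_pow_mulVec [Finite κ] {S : Matrix ι ι ℝ}
    (hS : ∀ z ∈ spectrum ℂ (S.map Complex.ofRealHom), 1 ≤ ‖z‖) {Z : Matrix κ ι ℝ}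
    (hZ : ∀ v, Tendsto (fun k => Z *ᵥ (S ^ k *ᵥ v)) atTop (𝓝 0)) : Z = 0 :=
  eq_zero_of_tendsto_mul_pow hS <| tendsto_zero_iff_forall_mulVec.mpr fun v => by
    simpa only [Matrix.mulVec_mulVec] using hZ v

-- The trace of a Schur stable matrix is bounded by its size, but the trace of `A + t BᵀB` is affine
-- in `t` with slope `tr (BᵀB)`.
theorem eq_zero_of_forall_isSchur {A B : Matrix ι ι ℝ}
    (h : ∀ t : ℝ, IsSchur (A + t • (Bᵀ * B))) : B = 0 := by
  have htrace : ∀ t : ℝ, |A.trace + t * (Bᵀ * B).trace| ≤ Fintype.card ι := fun t => by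
    have hle := norm_trace_le_of_forall_spectrum fun z hz => (h t z hz).le
    rwa [← AddMonoidHom.map_trace, Complex.ofRealHom_eq_coe, Complex.norm_real, Real.norm_eq_abs,
      Matrix.trace_add, Matrix.trace_smul, smul_eq_mul, mul_one] at hle
  have h0 : (Bᵀ * B).trace = 0 := by
    by_contra hne
    have hle := htrace ((Fintype.card ι + 1 - A.trace) / (Bᵀ * B).trace)
    rw [div_mul_cancel₀ _ hne, add_sub_cancel, abs_of_pos (by positivity)] at hle
    linarith
  rw [← Matrix.conjTranspose_eq_transpose_of_trivial] at h0
  exact Matrix.trace_conjTranspose_mul_self_eq_zero_iff.mp h0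

end Schur

section Substochastic

variable {ι : Type*} [Fintype ι] {P : Matrix ι ι ℝ} {u : ι → ℝ} {i : ι}

-- At a maximum of `u` the terms `P i j * (u i - u j)` and `(1 - ∑ j, P i j) * u i` are nonnegative,
-- while their sum `u i - (P *ᵥ u) i` is not positive.
theorem eq_and_eq_zero_of_le_mulVec_of_forall_le (hP : ∀ j, 0 ≤ P i j) (hrow : ∑ j, P i j ≤ 1)
    (hu0 : 0 ≤ u i) (hu : u i ≤ (P *ᵥ u) i) (hmax : ∀ j, u j ≤ u i) :
    (∀ j, 0 < P i j → u j = u i) ∧ (∑ j, P i j < 1 → u i = 0) := by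
  have hterm : ∀ j ∈ Finset.univ, 0 ≤ P i j * (u i - u j) := fun j _ =>
    mul_nonneg (hP j) (sub_nonneg.mpr (hmax j))
  have hdefect : 0 ≤ (1 - ∑ j, P i j) * u i := mul_nonneg (sub_nonneg.mpr hrow) hu0
  have hsum : ∑ j, P i j * (u i - u j) = (∑ j, P i j) * u i - (P *ᵥ u) i := by
    simp only [mul_sub, Finset.sum_sub_distrib, Finset.sum_mul, Matrix.mulVec, dotProduct]
  have hle : ∑ j, P i j * (u i - u j) + (1 - ∑ j, P i j) * u i ≤ 0 := by linarith
  have hsum0 : ∑ j, P i j * (u i - u j) = 0 :=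
    le_antisymm ((le_add_of_nonneg_right hdefect).trans hle) (Finset.sum_nonneg hterm)
  refine ⟨fun j hj => ?_, fun hlt => ?_⟩
  · have h0 := (Finset.sum_eq_zero_iff_of_nonneg hterm).mp hsum0 j (Finset.mem_univ j)
    linarith [(mul_eq_zero.mp h0).resolve_left hj.ne']
  · rw [hsum0, zero_add] at hle
    have h0 : (1 - ∑ j, P i j) * u i = 0 := le_antisymm hle hdefect
    exact (mul_eq_zero.mp h0).resolve_left (sub_pos.mpr hlt).ne'

theorem eq_zero_of_le_mulVec (hP : ∀ i j, 0 ≤ P i j) (hrow : ∀ i, ∑ j, P i j ≤ 1)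
    (hreach : ∀ i, ∃ j, ReflTransGen (fun i j => 0 < P i j) i j ∧ ∑ k, P j k < 1)
    (hu0 : 0 ≤ u) (hu : u ≤ P *ᵥ u) : u = 0 := by
  rcases isEmpty_or_nonempty ι with _ | _
  · exact Subsingleton.elim _ _
  obtain ⟨top, htop⟩ := Finite.exists_max u
  obtain ⟨out, hpath, hout⟩ := hreach top
  have hstep : ∀ i, u i = u top → (∀ j, 0 < P i j → u j = u i) ∧ (∑ j, P i j < 1 → u i = 0) :=
    fun i hi => eq_and_eq_zero_of_le_mulVec_of_forall_le (hP i) (hrow i) (hu0 i) (hu i) (hi ▸ htop)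
  have heq : ∀ {i}, ReflTransGen (fun i j => 0 < P i j) top i → u i = u top := fun h => by
    induction h with
    | refl => rfl
    | tail _ hij ih => exact ((hstep _ ih).1 _ hij).trans ih
  have htop0 : u top = 0 := heq hpath ▸ (hstep out (heq hpath)).2 hout
  exact funext fun i => le_antisymm ((htop i).trans_eq htop0) (hu0 i)

theorem isSchur_of_substochastic [DecidableEq ι] (hP : ∀ i j, 0 ≤ P i j)
    (hrow : ∀ i, ∑ j, P i j ≤ 1)
    (hreach : ∀ i, ∃ j, ReflTransGen (fun i j => 0 < P i j) i j ∧ ∑ k, P j k < 1) :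
    IsSchur P := fun z hz => by
  rw [← Matrix.spectrum_toLin', ← Module.End.hasEigenvalue_iff_mem_spectrum] at hz
  obtain ⟨v, hv⟩ := hz.exists_hasEigenvector
  by_contra! hz1
  suffices hnorm : (fun i => ‖v i‖) = 0 from
    hv.2 (funext fun i => norm_eq_zero.mp (congrFun hnorm i))
  refine eq_zero_of_le_mulVec hP hrow hreach (fun i => norm_nonneg _) fun i => ?_
  have hvi : ∑ j, (P i j : ℂ) * v j = z * v i := congrFun hv.apply_eq_smul i
  calc ‖v i‖ ≤ ‖z‖ * ‖v i‖ := le_mul_of_one_le_left (norm_nonneg _) hz1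
    _ = ‖∑ j, (P i j : ℂ) * v j‖ := by rw [hvi, norm_mul]
    _ ≤ ∑ j, ‖(P i j : ℂ) * v j‖ := norm_sum_le _ _
    _ = ∑ j, P i j * ‖v j‖ := by
      simp only [norm_mul, Complex.norm_real, Real.norm_of_nonneg (hP _ _)]

end Substochastic

section Graph

variable {N : ℕ} {a : Matrix (Fin N) (Fin N) ℝ} {g : Fin N → ℝ}

theorem one_add_degree_add_pos (ha : ∀ i j, 0 ≤ a i j) (hg : ∀ i, 0 ≤ g i) (i : Fin N) :
    0 < 1 + degree a i + g i := by
  have hdeg : 0 ≤ degree a i := Finset.sum_nonneg fun j _ => ha i j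
  linarith [hg i]

theorem couplingMatrix_apply (h : ∀ i, 1 + degree a i + g i ≠ 0) (i j : Fin N) :
    couplingMatrix a g i j = (1 + degree a i + g i)⁻¹ * (laplacian a + Matrix.diagonal g) i j := by
  have hinv : (1 + Matrix.diagonal (degree a) + Matrix.diagonal g)⁻¹ =
      Matrix.diagonal fun i => (1 + degree a i + g i)⁻¹ := by
    refine Matrix.inv_eq_right_inv ?_
    rw [← Matrix.diagonal_one, Matrix.diagonal_add, Matrix.diagonal_add,
      Matrix.diagonal_mul_diagonal]
    exact congrArg _ (funext fun i => mul_inv_cancel₀ (h i))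
  rw [couplingMatrix, hinv, Matrix.diagonal_mul]

theorem one_sub_couplingMatrix_apply (h : ∀ i, 1 + degree a i + g i ≠ 0) (i j : Fin N) :
    (1 - couplingMatrix a g) i j = (1 + degree a i + g i)⁻¹ * (1 + a) i j := by
  rw [Matrix.sub_apply, couplingMatrix_apply h, eq_inv_mul_iff_mul_eq₀ (h i), mul_sub,
    mul_inv_cancel_left₀ (h i)]
  rcases eq_or_ne i j with rfl | hij
  · simp [laplacian]
    ring
  · simp [laplacian, hij]

theorem isSchur_one_sub_couplingMatrix (ha : ∀ i j, 0 ≤ a i j) (hg : ∀ i, 0 ≤ g i)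
    (hroot : ∃ i, IsRootNode a i ∧ 0 < g i) : IsSchur (1 - couplingMatrix a g) := by
  have hpos := one_add_degree_add_pos ha hg
  have happly := one_sub_couplingMatrix_apply fun i => (hpos i).ne'
  have hsum : ∀ i, ∑ j, (1 - couplingMatrix a g) i j =
      (1 + degree a i + g i)⁻¹ * (1 + degree a i) := fun i => by
    simp only [happly, ← Finset.mul_sum, Matrix.add_apply, Finset.sum_add_distrib, degree,
      Matrix.one_apply, Finset.sum_ite_eq, Finset.mem_univ, if_true]
  have hone : ∀ i j, 0 ≤ (1 : Matrix (Fin N) (Fin N) ℝ) i j := fun i j => by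
    rw [Matrix.one_apply]
    positivity
  obtain ⟨root, ⟨T, hT⟩, hgroot⟩ := hroot
  refine isSchur_of_substochastic (fun i j => ?_) (fun i => ?_) fun i => ⟨root, ?_, ?_⟩
  · rw [happly]
    exact mul_nonneg (inv_nonneg.mpr (hpos i).le) (add_nonneg (hone i j) (ha i j))
  · rw [hsum, inv_mul_le_one₀ (hpos i)]
    linarith [hg i]
  · refine ReflTransGen.mono (fun k l hlk => ?_) _ _ (hT.connects i).swap
    have hkl : 0 < a k l := (ha k l).lt_of_ne' (hT.isSubgraph l k hlk)
    rw [happly]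
    exact mul_pos (inv_pos.mpr (hpos k)) (add_pos_of_nonneg_of_pos (hone k l) hkl)
  · rw [hsum, inv_mul_lt_one₀ (hpos root)]
    linarith

theorem norm_one_sub_lt_one_of_mem_spectrum_couplingMatrix (ha : ∀ i j, 0 ≤ a i j)
    (hg : ∀ i, 0 ≤ g i) (hroot : ∃ i, IsRootNode a i ∧ 0 < g i) {l : ℂ}
    (hl : l ∈ spectrum ℂ (toC (couplingMatrix a g))) : ‖1 - l‖ < 1 := by
  have hmap : (1 - couplingMatrix a g).map Complex.ofRealHom =
      algebraMap ℂ _ 1 - toC (couplingMatrix a g) := by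
    rw [map_one]
    exact (map_sub Complex.ofRealHom.mapMatrix 1 (couplingMatrix a g)).trans
      (congrArg (· - _) (map_one Complex.ofRealHom.mapMatrix))
  refine isSchur_one_sub_couplingMatrix ha hg hroot _ ?_
  rw [hmap, ← spectrum.singleton_sub_eq]
  exact Set.sub_mem_sub rfl hl

theorem simultaneouslyStabilizes_self (ha : ∀ i j, 0 ≤ a i j) (hg : ∀ i, 0 ≤ g i)
    (hroot : ∃ i, IsRootNode a i ∧ 0 < g i) {r : ℕ} {S : Matrix (Fin r) (Fin r) ℝ}
    (hS : ∀ z ∈ spectrum ℂ (toC S), ‖z‖ ≤ 1) : SimultaneouslyStabilizes a g S S :=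
  fun l hl z hz => by
    rw [← one_smul ℂ (toC S), smul_smul, mul_one, ← sub_smul] at hz
    exact norm_lt_one_of_mem_spectrum_smul hS
      (norm_one_sub_lt_one_of_mem_spectrum_couplingMatrix ha hg hroot hl) hz

end Graph

section ClosedLoop

theorem coupling_input_eq {N : ℕ} {a : Matrix (Fin N) (Fin N) ℝ} {g : Fin N → ℝ} {V : Type*}
    [AddCommGroup V] [Module ℝ V] (h : ∀ i, 1 + degree a i + g i ≠ 0) (w : Fin N → V) (x : V)
    (i : Fin N) :
    (1 + degree a i + g i)⁻¹ • (∑ j, a i j • (w j - w i) + g i • (x - w i)) =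
      -∑ j, couplingMatrix a g i j • (w j - x) := by
  have hlap : ∑ j, (laplacian a + Matrix.diagonal g) i j • (w j - x) =
      (degree a i + g i) • (w i - x) - ∑ j, a i j • (w j - x) := by
    simp only [laplacian, Matrix.add_apply, Matrix.sub_apply, Matrix.diagonal_apply, add_smul,
      sub_smul, ite_smul, zero_smul, Finset.sum_add_distrib, Finset.sum_sub_distrib,
      Finset.sum_ite_eq, Finset.mem_univ, if_true]
    abel
  have hdeg : ∑ j, a i j • (w j - w i) = ∑ j, a i j • (w j - x) - degree a i • (w i - x) := by
    simp only [degree, Finset.sum_smul, ← Finset.sum_sub_distrib, ← smul_sub,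
      sub_sub_sub_cancel_right]
  simp only [couplingMatrix_apply h, mul_smul, ← Finset.smul_sum]
  rw [hlap, hdeg]
  module

theorem feedback_output_eq {l k m r : ℕ} (C : Matrix (Fin l) (Fin k) ℝ)
    (D : Matrix (Fin l) (Fin m) ℝ) (K : Matrix (Fin m) (Fin k) ℝ) (Pi : Matrix (Fin k) (Fin r) ℝ)
    (Gam : Matrix (Fin m) (Fin r) ℝ) (x : Fin k → ℝ) (v : Fin r → ℝ) :
    C *ᵥ x + D *ᵥ (K *ᵥ (x - Pi *ᵥ v) + Gam *ᵥ v) =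
      (C + D * K) *ᵥ (x - Pi *ᵥ v) + (C * Pi + D * Gam) *ᵥ v := by
  simp only [Matrix.add_mulVec, Matrix.mulVec_add, ← Matrix.mulVec_mulVec, Matrix.mulVec_sub]
  abel

/-- The gains `K`, `Pi`, `Gam` solve the output regulation problem of a single follower: the local
loop is stable and the regulator equations `A Π + B Γ = Π S` and `C Π + D Γ = R` hold. -/
structure FollowerSystem.IsRegulated {n m q r p : ℕ} (s : FollowerSystem n m q)
    (S : Matrix (Fin r) (Fin r) ℝ) (R : Matrix (Fin p) (Fin r) ℝ) (C : Matrix (Fin p) (Fin n) ℝ)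
    (D : Matrix (Fin p) (Fin m) ℝ) (K : Matrix (Fin m) (Fin n) ℝ) (Pi : Matrix (Fin n) (Fin r) ℝ)
    (Gam : Matrix (Fin m) (Fin r) ℝ) : Prop where
  stable : SchurStable (toC (s.A + s.B * K))
  state_eq : s.A * Pi + s.B * Gam = Pi * S
  output_eq : C * Pi + D * Gam = R

/-- The matrix whose columns are the errors `v_i - x_r` of the local controllers, so that the
distributed error dynamics become a single matrix recursion. -/
def syncError {N r : ℕ} (xr : ℕ → Fin r → ℝ) (v : Fin N → ℕ → Fin r → ℝ) (k : ℕ) :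
    Matrix (Fin r) (Fin N) ℝ :=
  Matrix.of fun c i => v i k c - xr k c

variable {N r p : ℕ} {n m q : Fin N → ℕ} {S : Matrix (Fin r) (Fin r) ℝ}
  {R : Matrix (Fin p) (Fin r) ℝ} {C : ∀ i, Matrix (Fin p) (Fin (n i)) ℝ}
  {D : ∀ i, Matrix (Fin p) (Fin (m i)) ℝ} {a : Matrix (Fin N) (Fin N) ℝ} {g : Fin N → ℝ}
  {sys : ∀ i, FollowerSystem (n i) (m i) (q i)} {P : Protocol n m r}
  {w : ∀ i, ℕ → Fin (q i) → ℝ} {xr : ℕ → Fin r → ℝ} {v : Fin N → ℕ → Fin r → ℝ}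
  {x : ∀ i, ℕ → Fin (n i) → ℝ}

theorem IsTrajectory.controller_succ (hd : ∀ i, 1 + degree a i + g i ≠ 0)
    (h : IsTrajectory S a g sys P w xr v x) (i : Fin N) (k : ℕ) :
    v i (k + 1) = S *ᵥ v i k - (P.F * syncError xr v k * (couplingMatrix a g)ᵀ).col i := by
  have hcol : (syncError xr v k * (couplingMatrix a g)ᵀ).col i =
      ∑ j, couplingMatrix a g i j • (v j k - xr k) := by
    ext c
    simp [Matrix.mul_apply, syncError, mul_comm]
  rw [h.controller, ← Matrix.mulVec_smul, coupling_input_eq hd (fun j => v j k), Matrix.mulVec_neg,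
    ← sub_eq_add_neg, Matrix.mul_assoc, ← hcol]
  rfl

theorem IsTrajectory.syncError_succ (hd : ∀ i, 1 + degree a i + g i ≠ 0)
    (h : IsTrajectory S a g sys P w xr v x) (k : ℕ) :
    syncError xr v (k + 1) =
      S * syncError xr v k - P.F * syncError xr v k * (couplingMatrix a g)ᵀ := by
  refine Matrix.ext_col fun i => ?_
  calc v i (k + 1) - xr (k + 1) = S *ᵥ (v i k - xr k) -
        (P.F * syncError xr v k * (couplingMatrix a g)ᵀ).col i := by
        rw [h.controller_succ hd, h.leader, Matrix.mulVec_sub]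
        abel
    _ = _ := rfl

theorem IsTrajectory.vec_syncError_succ (hd : ∀ i, 1 + degree a i + g i ≠ 0)
    (h : IsTrajectory S a g sys P w xr v x) (k : ℕ) :
    (syncError xr v (k + 1)).vec =
      ((1 : Matrix (Fin N) (Fin N) ℝ) ⊗ₖ S - couplingMatrix a g ⊗ₖ P.F) *ᵥ
        (syncError xr v k).vec := by
  rw [h.syncError_succ hd, Matrix.sub_mulVec, Matrix.kronecker_mulVec_vec,
    Matrix.kronecker_mulVec_vec, Matrix.transpose_one, Matrix.mul_one, Matrix.vec_sub]

theorem IsTrajectory.regulationError_succ (hd : ∀ i, 1 + degree a i + g i ≠ 0)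
    (h : IsTrajectory S a g sys P (fun _ _ => 0) xr v x) {i : Fin N}
    (hreg : (sys i).A * P.Pi i + (sys i).B * P.Gam i = P.Pi i * S) (k : ℕ) :
    x i (k + 1) - P.Pi i *ᵥ v i (k + 1) =
      (couplingMatrix a g ⊗ₖ (P.Pi i * P.F)).submatrix (Prod.mk i) id *ᵥ (syncError xr v k).vec +
        ((sys i).A + (sys i).B * P.K i) *ᵥ (x i k - P.Pi i *ᵥ v i k) := by
  have hL : (couplingMatrix a g ⊗ₖ (P.Pi i * P.F)).submatrix (Prod.mk i) id *ᵥ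
      (syncError xr v k).vec =
        P.Pi i *ᵥ (P.F * syncError xr v k * (couplingMatrix a g)ᵀ).col i := by
    have hvec : (couplingMatrix a g ⊗ₖ (P.Pi i * P.F)) *ᵥ (syncError xr v k).vec =
        (P.Pi i * (P.F * syncError xr v k * (couplingMatrix a g)ᵀ)).vec := by
      simp only [Matrix.kronecker_mulVec_vec, Matrix.mul_assoc]
    exact funext fun c => congrFun hvec (i, c)
  rw [h.follower, h.controller_succ hd, Protocol.input, feedback_output_eq, hreg, hL,
    Matrix.mulVec_sub (P.Pi i), ← Matrix.mulVec_mulVec (v i k) (P.Pi i) S, Matrix.mulVec_zero]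
  abel

theorem achievesOutputSync_of_isRegulated (hd : ∀ i, 1 + degree a i + g i ≠ 0)
    (hF : SimultaneouslyStabilizes a g S P.F)
    (hreg : ∀ i, (sys i).IsRegulated S R (C i) (D i) (P.K i) (P.Pi i) (P.Gam i)) :
    AchievesOutputSync S R C D a g sys P := fun xr v x h i => by
  have hloop : IsSchur ((1 : Matrix (Fin N) (Fin N) ℝ) ⊗ₖ S - couplingMatrix a g ⊗ₖ P.F) :=
    IsSchur.one_kronecker_sub hF
  have hsync : Tendsto (fun k => v i k - xr k) atTop (𝓝 0) := by
    have hvec : Tendsto (fun k => (syncError xr v k).vec) atTop (𝓝 0) :=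
      hloop.tendsto_of_recursion (h.vec_syncError_succ hd)
    exact tendsto_pi_nhds.mpr fun c => tendsto_pi_nhds.mp hvec (i, c)
  have htrack : Tendsto (fun k => x i k - P.Pi i *ᵥ v i k) atTop (𝓝 0) :=
    hloop.tendsto_of_cascade (hreg i).stable _ (x := fun k => (syncError xr v k).vec)
      (h.vec_syncError_succ hd) (h.regulationError_succ hd (hreg i).state_eq)
  refine ⟨?_, hsync, htrack⟩
  have hout := (tendsto_mulVec_zero (C i + D i * P.K i) htrack).add (tendsto_mulVec_zero R hsync)
  rw [add_zero] at hout
  refine hout.congr fun k => ?_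
  rw [Protocol.input, feedback_output_eq, (hreg i).output_eq, Matrix.mulVec_sub R]
  abel

theorem exists_synchronized_trajectory (S : Matrix (Fin r) (Fin r) ℝ)
    (a : Matrix (Fin N) (Fin N) ℝ) (g : Fin N → ℝ)
    (sys : ∀ i, FollowerSystem (n i) (m i) (q i)) (P : Protocol n m r) (v₀ : Fin r → ℝ)
    (x₀ : ∀ i, Fin (n i) → ℝ) :
    ∃ x : ∀ i, ℕ → Fin (n i) → ℝ, IsTrajectory S a g sys P (fun _ _ => 0)
      (fun k => S ^ k *ᵥ v₀) (fun _ k => S ^ k *ᵥ v₀) x ∧ ∀ i, x i 0 = x₀ i := by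
  refine ⟨fun i k => Nat.rec (x₀ i) (fun k y => (sys i).A *ᵥ y +
    (sys i).B *ᵥ P.input i y (S ^ k *ᵥ v₀)) k, ⟨fun k => ?_, fun i k => ?_, fun i k => ?_⟩,
    fun i => rfl⟩
  · rw [pow_succ', Matrix.mulVec_mulVec]
  · simp [pow_succ', Matrix.mulVec_mulVec]
  · simp

theorem AchievesOutputSync.exists_regulationError (h : AchievesOutputSync S R C D a g sys P)
    (i : Fin N) (v₀ : Fin r → ℝ) (e₀ : Fin (n i) → ℝ) :
    ∃ e : ℕ → Fin (n i) → ℝ, e 0 = e₀ ∧ Tendsto e atTop (𝓝 0) ∧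
      (∀ k, e (k + 1) = ((sys i).A + (sys i).B * P.K i) *ᵥ e k +
        ((sys i).A * P.Pi i + (sys i).B * P.Gam i - P.Pi i * S) *ᵥ (S ^ k *ᵥ v₀)) ∧
      Tendsto (fun k => (C i + D i * P.K i) *ᵥ e k +
        (C i * P.Pi i + D i * P.Gam i - R) *ᵥ (S ^ k *ᵥ v₀)) atTop (𝓝 0) := by
  obtain ⟨x, hx, hx0⟩ := exists_synchronized_trajectory S a g sys P v₀
    (Function.update (fun _ => 0) i (e₀ + P.Pi i *ᵥ v₀))
  obtain ⟨hout, -, htrack⟩ := h _ _ _ hx i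
  refine ⟨_, by simp [hx0], htrack, fun k => ?_, hout.congr fun k => ?_⟩
  · rw [hx.follower, Protocol.input, feedback_output_eq, pow_succ', Matrix.sub_mulVec,
      ← Matrix.mulVec_mulVec, Matrix.mulVec_zero, ← Matrix.mulVec_mulVec]
    abel
  · rw [Protocol.input, feedback_output_eq, Matrix.sub_mulVec]
    abel

theorem AchievesOutputSync.isRegulated (hS : ∀ z ∈ spectrum ℂ (toC S), 1 ≤ ‖z‖)
    (h : AchievesOutputSync S R C D a g sys P) (i : Fin N) :
    (sys i).IsRegulated S R (C i) (D i) (P.K i) (P.Pi i) (P.Gam i) where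
  stable := isSchur_iff_tendsto_pow.mpr <| tendsto_zero_iff_forall_mulVec.mpr fun e₀ => by
    obtain ⟨e, rfl, he, hsucc, -⟩ := h.exists_regulationError i 0 e₀
    exact he.congr fun k => (pow_mulVec_eq_of_recursion (fun k => by simp [hsucc]) k).symm
  state_eq := sub_eq_zero.mp <| eq_zero_of_forall_tendsto_mulVec_pow_mulVec hS fun v₀ => by
    obtain ⟨e, -, he, hsucc, -⟩ := h.exists_regulationError i v₀ 0
    have hsub := ((tendsto_add_atTop_iff_nat 1).mpr he).sub
      (tendsto_mulVec_zero ((sys i).A + (sys i).B * P.K i) he)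
    rw [sub_zero] at hsub
    exact hsub.congr fun k => by rw [hsucc, add_sub_cancel_left]
  output_eq := sub_eq_zero.mp <| eq_zero_of_forall_tendsto_mulVec_pow_mulVec hS fun v₀ => by
    obtain ⟨e, -, he, -, hout⟩ := h.exists_regulationError i v₀ 0
    have hsub := hout.sub (tendsto_mulVec_zero (C i + D i * P.K i) he)
    rw [sub_zero] at hsub
    exact hsub.congr fun k => add_sub_cancel_left _ _

end ClosedLoop

section Data

namespace FollowerData

variable {n m q τ r p : ℕ} {d : FollowerData n m q τ} {s s₀ : FollowerSystem n m q}
  {S : Matrix (Fin r) (Fin r) ℝ} {R : Matrix (Fin p) (Fin r) ℝ} {C : Matrix (Fin p) (Fin n) ℝ}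
  {D : Matrix (Fin p) (Fin m) ℝ} {K : Matrix (Fin m) (Fin n) ℝ} {Pi : Matrix (Fin n) (Fin r) ℝ}
  {Gam : Matrix (Fin m) (Fin r) ℝ} {Xd : Matrix (Fin τ) (Fin n) ℝ} {M : Matrix (Fin τ) (Fin r) ℝ}

/-- `s₀` solves the homogeneous equation `0 = A₀ X₋ + B₀ U₋ + E₀ W₋`; these are the differences of
two systems that explain the data. -/
def Annihilates (d : FollowerData n m q τ) (s₀ : FollowerSystem n m q) : Prop :=
  s₀.A * d.Xminus + s₀.B * d.U + s₀.E * d.W = 0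

theorem Annihilates.add_mem_systems (h : d.Annihilates s₀) (hs : s ∈ d.systems) :
    ⟨s.A + s₀.A, s.B + s₀.B, s.E + s₀.E⟩ ∈ d.systems := by
  calc d.Xplus = (s.A * d.Xminus + s.B * d.U + s.E * d.W) +
        (s₀.A * d.Xminus + s₀.B * d.U + s₀.E * d.W) := by rw [h, add_zero, ← hs]
    _ = (s.A + s₀.A) * d.Xminus + (s.B + s₀.B) * d.U + (s.E + s₀.E) * d.W := by
      simp only [Matrix.add_mul]
      abel

theorem Annihilates.mul_left (h : d.Annihilates s₀) (T : Matrix (Fin n) (Fin n) ℝ) :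
    d.Annihilates ⟨T * s₀.A, T * s₀.B, T * s₀.E⟩ := by
  simp only [Annihilates, Matrix.mul_assoc, ← Matrix.mul_add]
  rw [h, Matrix.mul_zero]

theorem Annihilates.schurStable_add_mul (h : d.Annihilates s₀) (hs : s ∈ d.systems)
    (hK : ∀ s ∈ d.systems, SchurStable (toC (s.A + s.B * K))) (T : Matrix (Fin n) (Fin n) ℝ) :
    SchurStable (toC (s.A + s.B * K + T * (s₀.A + s₀.B * K))) := by
  have hstable := hK _ ((h.mul_left T).add_mem_systems hs)
  rwa [Matrix.add_mul, add_add_add_comm, Matrix.mul_assoc T, ← Matrix.mul_add] at hstable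

theorem Annihilates.feedback_eq_zero (h : d.Annihilates s₀) (hs : s ∈ d.systems)
    (hK : ∀ s ∈ d.systems, SchurStable (toC (s.A + s.B * K))) : s₀.A + s₀.B * K = 0 := by
  refine eq_zero_of_forall_isSchur (A := s.A + s.B * K) fun t => ?_
  rw [← Matrix.smul_mul]
  exact h.schurStable_add_mul hs hK _

theorem Annihilates.regulator_eq_zero (h : d.Annihilates s₀) (hs : s ∈ d.systems)
    (heq : ∀ s ∈ d.systems, s.A * Pi + s.B * Gam = Pi * S) : s₀.A * Pi + s₀.B * Gam = 0 := by
  have hadd := heq _ (h.add_mem_systems hs)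
  rw [Matrix.add_mul, Matrix.add_mul, add_add_add_comm, heq s hs] at hadd
  exact add_eq_left.mp hadd

theorem exists_mul_eq_of_forall_annihilates (hn : 0 < n) {k : ℕ} {Y : Matrix (Fin n) (Fin k) ℝ}
    {Z : Matrix (Fin m) (Fin k) ℝ}
    (h : ∀ s₀, d.Annihilates s₀ → s₀.A * Y + s₀.B * Z = 0) :
    ∃ M : Matrix (Fin τ) (Fin k) ℝ, d.Xminus * M = Y ∧ d.U * M = Z ∧ d.W * M = 0 := by
  obtain ⟨M, hM⟩ := exists_mul_eq_of_forall_vecMul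
    (D := Matrix.fromRows d.Xminus (Matrix.fromRows d.U d.W))
    (Y := Matrix.fromRows Y (Matrix.fromRows Z 0)) fun f hf => by
      rw [Matrix.vecMul_fromRows, Matrix.vecMul_fromRows, ← add_assoc] at hf ⊢
      have hrows := h ⟨Matrix.of fun _ => f ∘ Sum.inl, Matrix.of fun _ => (f ∘ Sum.inr) ∘ Sum.inl,
        Matrix.of fun _ => (f ∘ Sum.inr) ∘ Sum.inr⟩ (Matrix.ext fun _ c => congrFun hf c)
      rw [Matrix.vecMul_zero, add_zero]
      exact congrFun hrows ⟨0, hn⟩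
  rw [Matrix.fromRows_mul, Matrix.fromRows_mul] at hM
  obtain ⟨hY, hZW⟩ := Matrix.fromRows_inj hM
  exact ⟨M, hY, Matrix.fromRows_inj hZW⟩

theorem Xplus_mul {κ : Type*} {Y : Matrix (Fin τ) κ ℝ} (hs : s ∈ d.systems) (hY : d.W * Y = 0) :
    d.Xplus * Y = s.A * (d.Xminus * Y) + s.B * (d.U * Y) := by
  have hplus : d.Xplus = s.A * d.Xminus + s.B * d.U + s.E * d.W := hs
  rw [hplus, Matrix.add_mul, Matrix.add_mul, Matrix.mul_assoc, Matrix.mul_assoc, Matrix.mul_assoc,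
    hY, Matrix.mul_zero, add_zero]

theorem exists_isStabilizingRightInverse (hn : 0 < n) (hs : s ∈ d.systems)
    (hK : ∀ s ∈ d.systems, SchurStable (toC (s.A + s.B * K))) :
    ∃ Xd, d.IsStabilizingRightInverse Xd := by
  obtain ⟨Xd, hX, hU, hW⟩ := exists_mul_eq_of_forall_annihilates hn (Y := 1) (Z := K)
    fun s₀ h₀ => by
      rw [Matrix.mul_one]
      exact h₀.feedback_eq_zero hs hK
  refine ⟨Xd, hX, ?_, hW⟩
  rw [Xplus_mul hs hW, hX, hU, Matrix.mul_one]
  exact hK s hs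

theorem exists_solvesLinearEquations (hn : 0 < n) (hs : s ∈ d.systems)
    (heq : ∀ s ∈ d.systems, s.A * Pi + s.B * Gam = Pi * S) (hout : C * Pi + D * Gam = R) :
    ∃ M, d.SolvesLinearEquations S R C D M := by
  obtain ⟨M, hX, hU, hW⟩ := exists_mul_eq_of_forall_annihilates hn
    fun s₀ h₀ => h₀.regulator_eq_zero hs heq
  refine ⟨M, ?_, hW, ?_⟩
  · rw [Xplus_mul hs hW, hX, hU, heq s hs, sub_self]
  · rw [Matrix.mul_assoc, Matrix.mul_assoc, hX, hU, hout]

theorem isRegulated_of_mem_systems (hs : s ∈ d.systems) (hXd : d.IsStabilizingRightInverse Xd)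
    (hM : d.SolvesLinearEquations S R C D M) :
    s.IsRegulated S R C D (d.U * Xd) (d.Xminus * M) (d.U * M) where
  stable := by
    obtain ⟨hX, hstable, hW⟩ := hXd
    rwa [Xplus_mul hs hW, hX, Matrix.mul_one] at hstable
  state_eq := by rw [← Xplus_mul hs hM.2.1, sub_eq_zero.mp hM.1]
  output_eq := by rw [← Matrix.mul_assoc, ← Matrix.mul_assoc, hM.2.2]

end FollowerData

variable {N r p τ : ℕ} {n m q : Fin N → ℕ} {S : Matrix (Fin r) (Fin r) ℝ}
  {R : Matrix (Fin p) (Fin r) ℝ} {C : ∀ i, Matrix (Fin p) (Fin (n i)) ℝ}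
  {D : ∀ i, Matrix (Fin p) (Fin (m i)) ℝ} {a : Matrix (Fin N) (Fin N) ℝ} {g : Fin N → ℝ}
  {data : ∀ i, FollowerData (n i) (m i) (q i) τ}

theorem AchievesOutputSyncForData.isRegulated {P : Protocol n m r}
    (h : AchievesOutputSyncForData S R C D a g data P) (hS : ∀ z ∈ spectrum ℂ (toC S), 1 ≤ ‖z‖)
    {sys : ∀ i, FollowerSystem (n i) (m i) (q i)} (hsys : ∀ i, sys i ∈ (data i).systems)
    (i : Fin N) {s : FollowerSystem (n i) (m i) (q i)} (hs : s ∈ (data i).systems) :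
    s.IsRegulated S R (C i) (D i) (P.K i) (P.Pi i) (P.Gam i) := by
  have hupdate : ∀ j, Function.update sys i s j ∈ (data j).systems :=
    (Function.forall_update_iff sys fun j s => s ∈ (data j).systems).mpr ⟨hs, fun j _ => hsys j⟩
  simpa only [Function.update_self] using (h _ hupdate).isRegulated hS i

/-- The protocol whose gains are read off the data: `K = U₋ X₋†`, `Π = X₋ M` and `Γ = U₋ M`. -/
def dataProtocol (data : ∀ i, FollowerData (n i) (m i) (q i) τ) (F : Matrix (Fin r) (Fin r) ℝ)
    (Xd : ∀ i, Matrix (Fin τ) (Fin (n i)) ℝ) (M : Fin N → Matrix (Fin τ) (Fin r) ℝ) :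
    Protocol n m r where
  F := F
  K i := (data i).U * Xd i
  Pi i := (data i).Xminus * M i
  Gam i := (data i).U * M i

theorem achievesOutputSyncForData_dataProtocol (hd : ∀ i, 1 + degree a i + g i ≠ 0)
    {F : Matrix (Fin r) (Fin r) ℝ} {Xd : ∀ i, Matrix (Fin τ) (Fin (n i)) ℝ}
    {M : Fin N → Matrix (Fin τ) (Fin r) ℝ} (hF : SimultaneouslyStabilizes a g S F)
    (hXd : ∀ i, (data i).IsStabilizingRightInverse (Xd i))
    (hM : ∀ i, (data i).SolvesLinearEquations S R (C i) (D i) (M i)) :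
    AchievesOutputSyncForData S R C D a g data (dataProtocol data F Xd M) :=
  fun _ hsys => achievesOutputSync_of_isRegulated hd hF fun i =>
    FollowerData.isRegulated_of_mem_systems (hsys i) (hXd i) (hM i)

end Data

end OutputSync

theorem theorem1_general {N r p τ : ℕ} {n m q : Fin N → ℕ} (hn : ∀ i, 0 < n i)
    (S : Matrix (Fin r) (Fin r) ℝ) (R : Matrix (Fin p) (Fin r) ℝ)
    (C : ∀ i, Matrix (Fin p) (Fin (n i)) ℝ) (D : ∀ i, Matrix (Fin p) (Fin (m i)) ℝ)
    (a : Matrix (Fin N) (Fin N) ℝ) (g : Fin N → ℝ)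
    (ha : ∀ i j, 0 ≤ a i j) (hg : ∀ i, 0 ≤ g i)
    (hS : ∀ z ∈ spectrum ℂ (OutputSync.toC S), ‖z‖ = 1)
    (hroot : ∃ i, OutputSync.IsRootNode a i ∧ 0 < g i)
    (data : ∀ i, OutputSync.FollowerData (n i) (m i) (q i) τ)
    (trueSys : ∀ i, OutputSync.FollowerSystem (n i) (m i) (q i))
    (htrue : ∀ i, trueSys i ∈ (data i).systems) :
    (OutputSync.InformativeForOutputSync S R C D a g data ↔
      ∀ i, (∃ Xd : Matrix (Fin τ) (Fin (n i)) ℝ, (data i).IsStabilizingRightInverse Xd) ∧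
        ∃ M : Matrix (Fin τ) (Fin r) ℝ, (data i).SolvesLinearEquations S R (C i) (D i) M) ∧
    (∃ F : Matrix (Fin r) (Fin r) ℝ, OutputSync.SimultaneouslyStabilizes a g S F) ∧
    ∀ (F : Matrix (Fin r) (Fin r) ℝ) (Xd : ∀ i, Matrix (Fin τ) (Fin (n i)) ℝ)
      (M : Fin N → Matrix (Fin τ) (Fin r) ℝ),
      OutputSync.SimultaneouslyStabilizes a g S F →
      (∀ i, (data i).IsStabilizingRightInverse (Xd i)) →
      (∀ i, (data i).SolvesLinearEquations S R (C i) (D i) (M i)) →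
      OutputSync.AchievesOutputSyncForData S R C D a g data
        (OutputSync.dataProtocol data F Xd M) := by
  have hd : ∀ i, 1 + OutputSync.degree a i + g i ≠ 0 := fun i =>
    (OutputSync.one_add_degree_add_pos ha hg i).ne'
  have hF : OutputSync.SimultaneouslyStabilizes a g S S :=
    OutputSync.simultaneouslyStabilizes_self ha hg hroot fun z hz => (hS z hz).le
  refine ⟨⟨fun ⟨P, hP⟩ i => ?_, fun h => ?_⟩, ⟨S, hF⟩, fun F Xd M =>
    OutputSync.achievesOutputSyncForData_dataProtocol hd⟩
  · have hreg : ∀ s ∈ (data i).systems, s.IsRegulated S R (C i) (D i) (P.K i) (P.Pi i) (P.Gam i) :=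
      fun s hs => hP.isRegulated (fun z hz => (hS z hz).ge) htrue i hs
    exact ⟨OutputSync.FollowerData.exists_isStabilizingRightInverse (hn i) (htrue i)
        fun s hs => (hreg s hs).stable,
      OutputSync.FollowerData.exists_solvesLinearEquations (hn i) (htrue i)
        (fun s hs => (hreg s hs).state_eq) (hreg _ (htrue i)).output_eq⟩
  · choose Xd hXd using fun i => (h i).1
    choose M hM using fun i => (h i).2
    exact ⟨_, OutputSync.achievesOutputSyncForData_dataProtocol hd hF hXd hM⟩

theorem theorem1 {N r p τ : ℕ} {n m q : Fin N → ℕ} (hn : ∀ i, 0 < n i)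
    (S : Matrix (Fin r) (Fin r) ℝ) (R : Matrix (Fin p) (Fin r) ℝ)
    (C : ∀ i, Matrix (Fin p) (Fin (n i)) ℝ) (D : ∀ i, Matrix (Fin p) (Fin (m i)) ℝ)
    (a : Matrix (Fin N) (Fin N) ℝ) (g : Fin N → ℝ)
    (ha : ∀ i j, 0 ≤ a i j) (hg : ∀ i, 0 ≤ g i)
    (hS : OutputSync.SimpleUnitCircleSpectrum S) (hgraph : OutputSync.GraphAssumption a g)
    (data : ∀ i, OutputSync.FollowerData (n i) (m i) (q i) τ)
    (trueSys : ∀ i, OutputSync.FollowerSystem (n i) (m i) (q i))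
    (htrue : ∀ i, trueSys i ∈ (data i).systems) :
    (OutputSync.InformativeForOutputSync S R C D a g data ↔
      ∀ i, (∃ Xd : Matrix (Fin τ) (Fin (n i)) ℝ, (data i).IsStabilizingRightInverse Xd) ∧
        ∃ M : Matrix (Fin τ) (Fin r) ℝ, (data i).SolvesLinearEquations S R (C i) (D i) M) ∧
    (∃ F : Matrix (Fin r) (Fin r) ℝ, OutputSync.SimultaneouslyStabilizes a g S F) ∧
    ∀ (F : Matrix (Fin r) (Fin r) ℝ) (Xd : ∀ i, Matrix (Fin τ) (Fin (n i)) ℝ)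
      (M : Fin N → Matrix (Fin τ) (Fin r) ℝ),
      OutputSync.SimultaneouslyStabilizes a g S F →
      (∀ i, (data i).IsStabilizingRightInverse (Xd i)) →
      (∀ i, (data i).SolvesLinearEquations S R (C i) (D i) (M i)) →
      OutputSync.AchievesOutputSyncForData S R C D a g data
        { F := F
          K := fun i => (data i).U * Xd i
          Pi := fun i => (data i).Xminus * M i
          Gam := fun i => (data i).U * M i } :=
  theorem1_general hn S R C D a g ha hg (fun z hz => (hS z hz).1) hgraph.2.2 data trueSys htrue
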